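/- **Theorem ($x_0$-strict decomposition).** Let $H$ be a complex Hilbert space with identity operator $I$, let $a, b \in E(H) = \{x \in B(H) : 0 \le x \le I\}$, and let $\mathcal M_1 \subseteq B(H)$ be the von Neumann algebra generated by $a$ and $b$. Let $x_0 \ge 0$ lie in the centre of $\mathcal M_1$ with $\|x_0\| < 1$. *Definitions.* Write $|w| = (w^*w)^{1/2}$, and write $a \triangle_{x_0} b$ if $|a-b| + |I-a-b| = I - x_0$. An element $x$ of a von Neumann algebra $\mathcal M$ with $0 \le x \le I$ is *strict* in $\mathcal M$ if, for projections $r, s \in \mathcal M$, $r \le x$ implies $r = 0$, and $x \le s$ implies $s = I$. The effect $a$ is *$x_0$-strict* in $\mathcal M_1$ if $(I-x_0)^{-1}(a - \tfrac12 x_0)$ is strict in $\mathcal M_1$; similarly for $b$. An *identification* of $\mathcal M$ with $\mathbb M_2(\mathcal M_0)$ is a $*$-isomorphism $\mathcal M \cong \mathbb M_2(\mathcal M_0)$, where $\mathcal M_0$ is an abelian von Neumann algebra. A projection $p \in \mathcal M$ is *$\mathbb M_2$-strict* with respect to such an identification if it corresponds to $$\begin{bmatrix} p_1^2 & p_1p_2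 \\ p_1p_2 & p_2^2 \end{bmatrix}$$ for some strict elements $p_1, p_2$ of $\mathcal M_0$ with $p_1^2 + p_2^2 = I$; it is *$\mathbb M_2$-strict in $\mathcal M$* if this holds for some identification. *Claim.* $a \triangle_{x_0} b$ with $a$ and $b$ both $x_0$-strict in $\mathcal M_1$ if and only if there exist $\mathbb M_2$-strict projections $p, q$ in $\mathcal M_1$ and positive elements $w_1, w_2$ of the centre of $\mathcal M_1$, both strict in $\mathcal M_1$, with $w_1 + w_2 = I - x_0$, such that $$a = x_0 c + w_1 p + w_2 q, \qquad b = x_0 c + w_1 p + w_2 q',$$ where $c = \tfrac12 I$ and $q' = I - q$. The equivalence also holds when $p$ and $q$ are required to be $\mathbb M_2$-strict with respect to one and the same identification of $\mathcal M_1$ with some $\mathbb M_2(\mathcal M_0)$. -/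

import Mathlib

universe u

noncomputable section

variable {H : Type u} [NormedAddCommGroup H] [InnerProductSpace ℂ H] [CompleteSpace H]

/-- The effects `E(H)`: the bounded operators `a` with `0 ≤ a ≤ I` in the Loewner order. -/
def effects (H : Type u) [NormedAddCommGroup H] [InnerProductSpace ℂ H] [CompleteSpace H] :
    Set (H →L[ℂ] H) :=
  Set.Icc 0 1

/-- The von Neumann algebra generated by a set `S` of bounded operators: the double commutant
of `S ∪ S*`. -/
def generatedVN (S : Set (H →L[ℂ] H)) : VonNeumannAlgebra H where
  toStarSubalgebra :=
    StarSubalgebra.centralizer ℂ (Set.centralizer (S ∪ star S))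
  centralizer_centralizer' := by
    change Set.centralizer (Set.centralizer
      (StarSubalgebra.centralizer ℂ (Set.centralizer (S ∪ star S)) : Set (H →L[ℂ] H))) =
      (StarSubalgebra.centralizer ℂ (Set.centralizer (S ∪ star S)) : Set (H →L[ℂ] H))
    rw [StarSubalgebra.coe_centralizer]
    exact Set.centralizer_centralizer_centralizer _

/-- `generatedVN S` contains `S`. -/
theorem subset_generatedVN (S : Set (H →L[ℂ] H)) :
    S ⊆ (generatedVN S : Set (H →L[ℂ] H)) := by
  intro x hx
  change x ∈ (StarSubalgebra.centralizer ℂ (Set.centralizer (S ∪ star S)) : Set (H →L[ℂ] H))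
  rw [StarSubalgebra.coe_centralizer]
  have hstar : star (Set.centralizer (S ∪ star S)) = Set.centralizer (S ∪ star S) := by
    ext y
    rw [Set.mem_star]
    constructor
    · intro h
      have h' := Set.star_mem_centralizer h
      rwa [star_star] at h'
    · exact fun h => Set.star_mem_centralizer h
  rw [hstar, Set.union_self]
  exact Set.subset_centralizer_centralizer (Or.inl hx)

/-- `generatedVN S` is the least von Neumann algebra containing `S`. -/
theorem generatedVN_le (S : Set (H →L[ℂ] H)) (N : VonNeumannAlgebra H)
    (hN : S ⊆ (N : Set (H →L[ℂ] H))) : generatedVN S ≤ N := by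
  intro x hx
  change x ∈ (StarSubalgebra.centralizer ℂ (Set.centralizer (S ∪ star S)) : Set (H →L[ℂ] H)) at hx
  rw [StarSubalgebra.coe_centralizer] at hx
  have hU : S ∪ star S ⊆ (N : Set (H →L[ℂ] H)) := by
    rintro y (hy | hy)
    · exact hN hy
    · have h := star_mem (hN hy)
      rwa [star_star] at h
  have h2 := Set.centralizer_subset (Set.centralizer_subset hU)
    (Set.centralizer_subset Set.subset_union_left hx)
  rwa [VonNeumannAlgebra.centralizer_centralizer] at h2

/-- The centre `M ∩ M'` of a von Neumann algebra `M`. -/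
def vnCentre (M : VonNeumannAlgebra H) : Set (H →L[ℂ] H) :=
  {x | x ∈ M ∧ x ∈ M.commutant}

/-- An effect `x` in `M` is strict in `M` if, for projections `p`, `q` of `M`,
`p ≤ x` forces `p = 0` and `x ≤ q` forces `q = I`. -/
def IsStrictIn (M : VonNeumannAlgebra H) (x : H →L[ℂ] H) : Prop :=
  x ∈ M ∧ x ∈ effects H ∧
    (∀ p ∈ M, IsStarProjection p → p ≤ x → p = 0) ∧
    (∀ q ∈ M, IsStarProjection q → x ≤ q → q = 1)

/-- `a △_{x₀} b`: the effect `x₀` lies in the centre of the von Neumann algebra generated by `a`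
and `b`, `‖x₀‖ < 1`, and `|a - b| + |I - a - b| = I - x₀`. -/
def IsCompatibleRel (x₀ a b : H →L[ℂ] H) : Prop :=
  x₀ ∈ effects H ∧ x₀ ∈ vnCentre (generatedVN {a, b}) ∧ ‖x₀‖ < 1 ∧
    CFC.abs (a - b) + CFC.abs (1 - a - b) = 1 - x₀

/-- `a` is `x₀`-strict in `M` if `(I - x₀)⁻¹ (a - ½ x₀)` is strict in `M`
(used only with `‖x₀‖ < 1`, where `I - x₀` is invertible). -/
def IsRelStrictIn (M : VonNeumannAlgebra H) (x₀ a : H →L[ℂ] H) : Prop :=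
  IsStrictIn M (Ring.inverse (1 - x₀) * (a - (1 / 2 : ℂ) • x₀))

/-- An identification of a von Neumann algebra `M` with `𝕄₂(M₀)`, where `M₀` is an abelian
von Neumann algebra: a `*`-isomorphism from `M` onto the `2 × 2` matrices over `M₀`. -/
structure M2Identification (M : VonNeumannAlgebra H) where
  /-- the Hilbert space on which `M₀` acts -/
  K : Type u
  [instNormedAddCommGroup : NormedAddCommGroup K]
  [instInnerProductSpace : InnerProductSpace ℂ K]
  [instCompleteSpace : CompleteSpace K]
  /-- the algebra of matrix entries -/
  M₀ : VonNeumannAlgebra K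
  abelian : ∀ x ∈ M₀, ∀ y ∈ M₀, x * y = y * x
  /-- the `*`-isomorphism -/
  Φ : M.toStarSubalgebra ≃⋆ₐ[ℂ] Matrix (Fin 2) (Fin 2) M₀.toStarSubalgebra

attribute [instance] M2Identification.instNormedAddCommGroup
  M2Identification.instInnerProductSpace M2Identification.instCompleteSpace

/-- `p` is a projection of `M` which, under the identification `F` of `M` with `𝕄₂(M₀)`, is the
matrix with rows `(p₁², p₁ p₂)` and `(p₁ p₂, p₂²)`, where `p₁`, `p₂` are strict in `M₀` and
`p₁² + p₂² = I`. -/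
def IsM2StrictVia {M : VonNeumannAlgebra H} (F : M2Identification M) (p : H →L[ℂ] H) : Prop :=
  IsStarProjection p ∧
  ∃ (hp : p ∈ M.toStarSubalgebra) (p₁ p₂ : F.M₀.toStarSubalgebra),
    IsStrictIn F.M₀ (p₁ : F.K →L[ℂ] F.K) ∧ IsStrictIn F.M₀ (p₂ : F.K →L[ℂ] F.K) ∧
    p₁ ^ 2 + p₂ ^ 2 = 1 ∧
    F.Φ ⟨p, hp⟩ = !![p₁ ^ 2, p₁ * p₂; p₁ * p₂, p₂ ^ 2]

/-- `p` is an `𝕄₂`-strict projection in `M`: it has the above form under some identification of `M`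
with `𝕄₂(M₀)`, `M₀` abelian. An identification may be composed with conjugation by a unitary
of `𝕄₂(M₀)`, so the notion is invariant under unitary equivalence in `M`. -/
def IsM2StrictProjection (M : VonNeumannAlgebra H) (p : H →L[ℂ] H) : Prop :=
  ∃ F : M2Identification M, IsM2StrictVia F p

/-- `w₁`, `w₂` are positive central elements of `M`, strict in `M`, with `w₁ + w₂ = I - x₀`, and
`a = x₀ c + w₁ p + w₂ q`, `b = x₀ c + w₁ p + w₂ (I - q)`, where `c = ½ I`. -/
def IsRelDecomposition (M : VonNeumannAlgebra H) (x₀ a b p q w₁ w₂ : H →L[ℂ] H) : Prop :=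
  (0 ≤ w₁ ∧ w₁ ∈ vnCentre M ∧ IsStrictIn M w₁) ∧
  (0 ≤ w₂ ∧ w₂ ∈ vnCentre M ∧ IsStrictIn M w₂) ∧
  w₁ + w₂ = 1 - x₀ ∧
  a = x₀ * ((1 / 2 : ℂ) • (1 : H →L[ℂ] H)) + w₁ * p + w₂ * q ∧
  b = x₀ * ((1 / 2 : ℂ) • (1 : H →L[ℂ] H)) + w₁ * p + w₂ * (1 - q)

end

/-! Work with `u = a - b` and `v = a + b - 1`, which determine `a` and `b`. If `|u| + |v| = I - x₀`
is central, then `w₂ = |u|` commutes with `u`, and with `v` because `w₂ = (I - x₀) - |v|`; so `w₂`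
and `w₁ = |v|` are central. Writing `u = (2q - 1) w₂` and `v = (2p - 1) w₁`
(`exists_projection_sign`) and solving for `a` and `b` gives the decomposition.

Strictness of `x` means that `x` and `1 - x` are injective (`isStrictIn_iff`); injectivity is
phrased throughout as left regularity in `B(H)`. For `a` and `b` it says that `w₁ P + w₂ Q` is
injective for every `P ∈ {p, 1 - p}`, `Q ∈ {q, 1 - q}`, which puts `p` and `q` in generic position:
`d = p - q` and `g = p + q - 1` are injective. They anticommute and `d² + g² = 1`, so their signs
are anticommuting symmetries, which yield matrix units over the centre. In this frame `p` and `q`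
have half-angle entries (`exists_M2Identification`).

Conversely, `a` and `b` act as central elements on a common kernel of `P` and `Q`. The projection
onto it is therefore central and cuts out an abelian summand, and `𝕄₂(M₀)` has no nonzero one
(`isLeftRegular_of_M2Identification`). This needs only some identification of the algebra, while the
forward direction produces a common one for `p` and `q`; hence both equivalences. -/

section Operators

/-! ### Commutants, strictness and signs in a von Neumann algebra. -/

variable {H : Type*} [NormedAddCommGroup H] [InnerProductSpace ℂ H] [CompleteSpace H]

theorem mem_commutant_of_commute_pair {a b z : H →L[ℂ] H} (ha : IsSelfAdjoint a)
    (hb : IsSelfAdjoint b) (hza : Commute z a) (hzb : Commute z b) :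
    z ∈ (generatedVN {a, b}).commutant := by
  rw [VonNeumannAlgebra.mem_commutant_iff]
  intro y hy
  have hy' : y ∈ ((StarSubalgebra.centralizer ℂ
      (Set.centralizer (({a, b} : Set (H →L[ℂ] H)) ∪ star {a, b})) :
        StarSubalgebra ℂ (H →L[ℂ] H)) : Set (H →L[ℂ] H)) := hy
  rw [StarSubalgebra.coe_centralizer] at hy'
  refine (hy' z (Or.inl ?_)).symm
  have key : ∀ c ∈ ({a, b} : Set (H →L[ℂ] H)), IsSelfAdjoint c ∧ c * z = z * c := by
    rintro c (rfl | rfl)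
    · exact ⟨ha, hza.symm.eq⟩
    · exact ⟨hb, hzb.symm.eq⟩
  rintro c (hc | hc)
  · exact (key c hc).2
  · have h := key _ hc
    rw [← (star_star c), h.1.star_eq]
    exact h.2

theorem mem_of_forall_commute {M : VonNeumannAlgebra H} {x : H →L[ℂ] H}
    (h : ∀ y ∈ M.commutant, Commute x y) : x ∈ M := by
  rw [← VonNeumannAlgebra.commutant_commutant M, VonNeumannAlgebra.mem_commutant_iff]
  exact fun y hy => (h y hy).symm.eq

theorem commute_of_mem_commutant {M : VonNeumannAlgebra H} {x y : H →L[ℂ] H}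
    (hx : x ∈ M) (hy : y ∈ M.commutant) : Commute x y :=
  VonNeumannAlgebra.mem_commutant_iff.1 hy x hx

theorem smul_mem_vn {M : VonNeumannAlgebra H} {x : H →L[ℂ] H} (c : ℂ) (hx : x ∈ M) :
    c • x ∈ M :=
  M.toStarSubalgebra.smul_mem hx c

/-- The centre of a von Neumann algebra, as a von Neumann algebra. -/
noncomputable def centreVN (M : VonNeumannAlgebra H) : VonNeumannAlgebra H where
  toStarSubalgebra := M.toStarSubalgebra ⊓ M.commutant.toStarSubalgebra
  centralizer_centralizer' := by
    apply Set.Subset.antisymm _ Set.subset_centralizer_centralizer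
    intro x hx
    refine ⟨?_, ?_⟩
    · have := Set.centralizer_subset
        (Set.centralizer_subset (show _ ⊆ (M : Set (H →L[ℂ] H)) from fun y hy => hy.1)) hx
      exact (VonNeumannAlgebra.centralizer_centralizer M).subset this
    · have := Set.centralizer_subset
        (Set.centralizer_subset (show _ ⊆ (M.commutant : Set (H →L[ℂ] H)) from fun y hy => hy.2)) hx
      exact (VonNeumannAlgebra.centralizer_centralizer M.commutant).subset this

theorem mem_vnCentre {M : VonNeumannAlgebra H} {x : H →L[ℂ] H} :
    x ∈ vnCentre M ↔ x ∈ centreVN M :=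
  Iff.rfl

theorem commute_of_mem_centreVN {M : VonNeumannAlgebra H} {x y : H →L[ℂ] H}
    (hx : x ∈ centreVN M) (hy : y ∈ M) : Commute x y :=
  (commute_of_mem_commutant hy hx.2).symm

theorem abs_mem_vn {M : VonNeumannAlgebra H} {x : H →L[ℂ] H} (hx : x ∈ M) : CFC.abs x ∈ M :=
  mem_of_forall_commute fun _ hy =>
    Commute.cfcAbs_left (commute_of_mem_commutant hx hy)
      (commute_of_mem_commutant hx (star_mem hy))

theorem commute_sqrt {x y : H →L[ℂ] H} (hx : 0 ≤ x) (h : Commute x y) :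
    Commute (CFC.sqrt x) y := by
  rw [CFC.sqrt_eq_real_sqrt x hx]
  exact IsSelfAdjoint.commute_cfcₙ (IsSelfAdjoint.of_nonneg hx) h _

theorem sqrt_mem_vn {M : VonNeumannAlgebra H} {x : H →L[ℂ] H} (hx0 : 0 ≤ x) (hx : x ∈ M) :
    CFC.sqrt x ∈ M :=
  mem_of_forall_commute fun _ hy => commute_sqrt hx0 (commute_of_mem_commutant hx hy)

/-- The projection onto the kernel of an element of a von Neumann algebra lies in the algebra. -/
theorem exists_kernel_projection {M : VonNeumannAlgebra H} {x : H →L[ℂ] H} (hx : x ∈ M) :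
    ∃ r ∈ M, IsStarProjection r ∧ x * r = 0 ∧ ∀ z : H →L[ℂ] H, x * z = 0 → r * z = z := by
  have hcl : IsClosed ((LinearMap.ker (x : H →ₗ[ℂ] H) : Submodule ℂ H) : Set H) :=
    ContinuousLinearMap.isClosed_ker x
  have : CompleteSpace (LinearMap.ker (x : H →ₗ[ℂ] H) : Submodule ℂ H) :=
    hcl.completeSpace_coe
  set K : Submodule ℂ H := LinearMap.ker (x : H →ₗ[ℂ] H) with hK
  have hp : IsStarProjection K.starProjection := isStarProjection_starProjection
  refine ⟨K.starProjection, ?_, hp, ?_, ?_⟩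
  · rw [VonNeumannAlgebra.IsStarProjection.mem_iff hp]
    intro y hy
    rw [Module.End.mem_invtSubmodule_iff_forall_mem_of_mem]
    intro ξ hξ
    have hr : K.starProjection.range = K := Submodule.range_starProjection K
    rw [hr] at hξ ⊢
    have hξ' : x ξ = 0 := hξ
    change x (y ξ) = 0
    have h := congrArg (fun T : H →L[ℂ] H => T ξ) (commute_of_mem_commutant hx hy).eq
    simp only [mul_apply_eq_comp, hξ', map_zero] at h
    exact h
  · ext ξ
    exact (K.starProjection_apply_mem ξ : K.starProjection ξ ∈ K)
  · intro z hz
    ext ξ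
    have : z ξ ∈ K := congrArg (fun T : H →L[ℂ] H => T ξ) hz
    exact Submodule.starProjection_eq_self_iff.2 this

/-- With `S = √T`, the hypothesis reads `(S z)* (S z) = 0`. -/
theorem mul_eq_zero_of_conjugate_eq_zero {T z : H →L[ℂ] H} (hT : 0 ≤ T)
    (h : star z * T * z = 0) : T * z = 0 := by
  have hs : IsSelfAdjoint (CFC.sqrt T) := IsSelfAdjoint.of_nonneg (CFC.sqrt_nonneg T)
  have h1 : star (CFC.sqrt T * z) * (CFC.sqrt T * z) = 0 := by
    rw [star_mul, hs.star_eq, ← h]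
    conv_rhs => rw [← CFC.sqrt_mul_sqrt_self T hT]
    simp only [mul_assoc]
  have h2 : CFC.sqrt T * z = 0 := CStarRing.star_mul_self_eq_zero_iff _ |>.1 h1
  rw [← CFC.sqrt_mul_sqrt_self T hT, mul_assoc, h2, mul_zero]

theorem mul_eq_zero_of_add_mul_eq_zero {S T z : H →L[ℂ] H} (hS : 0 ≤ S) (hT : 0 ≤ T)
    (h : (S + T) * z = 0) : S * z = 0 := by
  apply mul_eq_zero_of_conjugate_eq_zero hS
  have h1 : star z * S * z + star z * T * z = 0 := by
    rw [← add_mul, ← mul_add, mul_assoc, h, mul_zero]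
  exact ((add_eq_zero_iff_of_nonneg (star_left_conjugate_nonneg hS z)
    (star_left_conjugate_nonneg hT z)).1 h1).1

theorem isLeftRegular_add_of_nonneg {S T : H →L[ℂ] H} (hS : 0 ≤ S) (hT : 0 ≤ T)
    (h : IsLeftRegular S) : IsLeftRegular (S + T) :=
  isLeftRegular_iff_right_eq_zero_of_mul.2 fun z hz =>
    isLeftRegular_iff_right_eq_zero_of_mul.1 h z (mul_eq_zero_of_add_mul_eq_zero hS hT hz)

/-- An effect is strict if and only if `0` and `1` are not eigenvalues. -/
theorem isStrictIn_iff {M : VonNeumannAlgebra H} {x : H →L[ℂ] H} :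
    IsStrictIn M x ↔ x ∈ M ∧ (0 ≤ x ∧ x ≤ 1) ∧ IsLeftRegular x ∧ IsLeftRegular (1 - x) := by
  unfold IsStrictIn effects
  rw [Set.mem_Icc]
  refine and_congr_right fun hxM => and_congr_right fun ⟨hx0, hx1⟩ => ?_
  have hxs : star x = x := (IsSelfAdjoint.of_nonneg hx0).star_eq
  constructor
  · rintro ⟨h0, h1⟩
    constructor
    · obtain ⟨r, hrM, hr, hxr, hz⟩ := exists_kernel_projection hxM
      have hrx : r * x = 0 := by
        have := congrArg star hxr
        simpa [star_mul, hxs, hr.isSelfAdjoint.star_eq] using this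
      -- As `x r = r x = 0`, compressing `1 - x ≥ 0` by `1 - r` gives `1 - r - x`.
      have hle : x ≤ 1 - r := by
        have h := star_left_conjugate_nonneg (sub_nonneg.2 hx1) (1 - r)
        have hs : star (1 - r) = 1 - r := hr.one_sub.isSelfAdjoint.star_eq
        have hrr : r * r = r := hr.isIdempotentElem
        have e : star (1 - r) * (1 - x) * (1 - r) = 1 - r - x := by
          rw [hs]
          linear_combination (norm := noncomm_ring) hrr + hxr + hrx - hrx * r
        rw [e] at h
        exact sub_nonneg.1 h
      have hr1 := h1 _ (sub_mem (one_mem M) hrM) hr.one_sub hle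
      have hr0 : r = 0 := by simpa using hr1
      refine isLeftRegular_iff_right_eq_zero_of_mul.2 fun z hxz => ?_
      rw [← hz z hxz, hr0, zero_mul]
    · obtain ⟨r, hrM, hr, hxr, hz⟩ := exists_kernel_projection (sub_mem (one_mem M) hxM)
      have hrx : r * (1 - x) = 0 := by
        have := congrArg star hxr
        simpa [star_mul, hxs, hr.isSelfAdjoint.star_eq] using this
      have hle : r ≤ x := by
        have h := star_left_conjugate_nonneg hx0 (1 - r)
        have hs : star (1 - r) = 1 - r := hr.one_sub.isSelfAdjoint.star_eq
        have hrr : r * r = r := hr.isIdempotentElem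
        have e : star (1 - r) * x * (1 - r) = x - r := by
          rw [hs]
          linear_combination (norm := noncomm_ring) hxr + hrx - hrx * r + hrr
        rw [e] at h
        exact sub_nonneg.1 h
      have hr0 := h0 _ hrM hr hle
      refine isLeftRegular_iff_right_eq_zero_of_mul.2 fun z hxz => ?_
      rw [← hz z hxz, hr0, zero_mul]
  · rintro ⟨h0, h1⟩
    rw [isLeftRegular_iff_right_eq_zero_of_mul] at h0 h1
    constructor
    · intro p _ hp hle
      have hpp : p * p = p := hp.isIdempotentElem
      have hps : star p = p := hp.isSelfAdjoint.star_eq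
      -- From `p ≤ x`, the compression `p (1 - x) p` is both `≥ 0` and `≤ 0`, so `(1 - x) p = 0`.
      apply h1
      apply mul_eq_zero_of_conjugate_eq_zero (sub_nonneg.2 hx1)
      apply le_antisymm _ (star_left_conjugate_nonneg (sub_nonneg.2 hx1) p)
      have h := star_left_conjugate_nonneg (sub_nonneg.2 hle) p
      rw [hps] at h ⊢
      rw [← neg_nonneg]
      have e : -(p * (1 - x) * p) = p * (x - p) * p := by
        linear_combination (norm := noncomm_ring) p * hpp
      rwa [e]
    · intro q _ hq hle
      have hqq : q * q = q := hq.isIdempotentElem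
      have hqs : star (1 - q) = 1 - q := hq.one_sub.isSelfAdjoint.star_eq
      suffices 1 - q = 0 from (sub_eq_zero.1 this).symm
      apply h0
      apply mul_eq_zero_of_conjugate_eq_zero hx0
      apply le_antisymm _ (star_left_conjugate_nonneg hx0 (1 - q))
      have h := star_left_conjugate_nonneg (sub_nonneg.2 hle) (1 - q)
      rw [hqs] at h ⊢
      rw [← neg_nonneg]
      have e : -((1 - q) * x * (1 - q)) = (1 - q) * (q - x) * (1 - q) := by
        linear_combination (norm := noncomm_ring) hqq - q * hqq
      rwa [e]

/-- A self-adjoint element `u` of a von Neumann algebra is the product of a symmetry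
`2 q - 1` of the algebra and `|u|`. -/
theorem exists_projection_sign {M : VonNeumannAlgebra H} {u : H →L[ℂ] H} (hu : u ∈ M)
    (hus : IsSelfAdjoint u) :
    ∃ q ∈ M, IsStarProjection q ∧ u = (2 * q - 1) * CFC.abs u := by
  -- `q` projects onto the space where `u = |u|`, which includes the kernel of `u`. Since `(|u| -
  -- u)(|u| + u) = 0`, `q` fixes `|u| + u`; it kills `|u| - u`, so `2 q |u| = |u| + u`.
  obtain ⟨q, hqM, hq, hxq, hz⟩ := exists_kernel_projection (sub_mem (abs_mem_vn hu) hu)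
  have hc : Commute (CFC.abs u) u := Commute.cfcAbs_left (Commute.refl u) (hus.star_eq.symm ▸ Commute.refl u)
  have habs : CFC.abs u * CFC.abs u = u * u := by rw [CFC.abs_mul_abs, hus.star_eq]
  refine ⟨q, hqM, hq, ?_⟩
  have has : star (CFC.abs u) = CFC.abs u := (IsSelfAdjoint.of_nonneg (CFC.abs_nonneg u)).star_eq
  have h1 : q * (CFC.abs u - u) = 0 := by
    have := congrArg star hxq
    simpa [star_mul, hus.star_eq, has, hq.isSelfAdjoint.star_eq] using this
  have h2 : q * (CFC.abs u + u) = CFC.abs u + u := by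
    apply hz
    linear_combination (norm := noncomm_ring) habs + hc.eq
  linear_combination (norm := noncomm_ring) -h1 - h2

theorem abs_symmetry_mul {w q : H →L[ℂ] H} (hw : 0 ≤ w) (hq : IsStarProjection q)
    (h : Commute w q) : CFC.abs (w * (2 * q - 1)) = w := by
  have hqq : q * q = q := hq.isIdempotentElem
  have hws : star w = w := (IsSelfAdjoint.of_nonneg hw).star_eq
  have hqs : star q = q := hq.isSelfAdjoint.star_eq
  apply CFC.sqrt_unique _ hw
  have e : star (w * (2 * q - 1)) = (2 * q - 1) * w := by
    simp only [star_mul, star_sub, star_one, hws, hqs, star_ofNat]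
    noncomm_ring
  rw [e]
  have hc : (2 * q - 1) * w = w * (2 * q - 1) := by
    linear_combination (norm := noncomm_ring) - 2 * h.eq
  have h2 : (2 * q - 1) * (2 * q - 1) = 1 := by
    linear_combination (norm := noncomm_ring) 4 * hqq
  calc w * w = w * ((2 * q - 1) * (2 * q - 1)) * w := by rw [h2, mul_one]
    _ = (2 * q - 1) * w * (w * (2 * q - 1)) := by
      rw [← hc, hc]; rw [mul_assoc, mul_assoc, hc, mul_assoc]

theorem commute_ringInverse {A : Type*} [Ring A] {y z : A} (hy : IsUnit y) (h : Commute y z) :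
    Commute (Ring.inverse y) z := by
  have h1 := Ring.inverse_mul_cancel y hy
  have h2 := Ring.mul_inverse_cancel y hy
  change Ring.inverse y * z = z * Ring.inverse y
  calc Ring.inverse y * z = Ring.inverse y * z * (y * Ring.inverse y) := by rw [h2, mul_one]
    _ = Ring.inverse y * (z * y) * Ring.inverse y := by simp only [mul_assoc]
    _ = Ring.inverse y * y * z * Ring.inverse y := by rw [← h.eq]; simp only [mul_assoc]
    _ = z * Ring.inverse y := by rw [h1, one_mul]

/-- Strictness of `y⁻¹ T` for an invertible central `y ≥ 0`. -/
theorem isStrictIn_ringInverse_mul_iff {M : VonNeumannAlgebra H} {y T : H →L[ℂ] H}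
    (hy0 : 0 ≤ y) (hy : y ∈ centreVN M) (hyu : IsUnit y) :
    IsStrictIn M (Ring.inverse y * T) ↔
      T ∈ M ∧ (0 ≤ T ∧ T ≤ y) ∧ IsLeftRegular T ∧ IsLeftRegular (y - T) := by
  have h1 := Ring.inverse_mul_cancel y hyu
  have h2 := Ring.mul_inverse_cancel y hyu
  -- Multiplication by `y⁻¹`, central, positive and invertible, preserves and reflects membership in
  -- `M`, positivity and injectivity; `1 - y⁻¹ T = y⁻¹ (y - T)` turns the bound `1` into `y`.
  have hiM : Ring.inverse y ∈ M := mem_of_forall_commute fun z hz =>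
    commute_ringInverse hyu (commute_of_mem_commutant hy.1 hz)
  have hi0 : 0 ≤ Ring.inverse y := by
    have h := star_left_conjugate_nonneg hy0 (Ring.inverse y)
    have hs : star (Ring.inverse y) = Ring.inverse y := by
      rw [← Ring.inverse_star, (IsSelfAdjoint.of_nonneg hy0).star_eq]
    rwa [hs, h1, one_mul] at h
  have hT : T = y * (Ring.inverse y * T) := by rw [← mul_assoc, h2, one_mul]
  have hsub : 1 - Ring.inverse y * T = Ring.inverse y * (y - T) := by rw [mul_sub, h1]
  have hreg : ∀ S : H →L[ℂ] H, IsLeftRegular (Ring.inverse y * S) ↔ IsLeftRegular S := by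
    intro S
    constructor
    · exact IsLeftRegular.of_mul
    · refine fun hS => IsLeftRegular.mul (isLeftRegular_iff_right_eq_zero_of_mul.2 ?_) hS
      intro z hz
      rw [← one_mul z, ← h2, mul_assoc, hz, mul_zero]
  have hmem : Ring.inverse y * T ∈ M ↔ T ∈ M := by
    constructor
    · intro h
      rw [hT]
      exact mul_mem hy.1 h
    · exact mul_mem hiM
  have hnn : ∀ S ∈ M, (0 ≤ Ring.inverse y * S ↔ 0 ≤ S) := by
    intro S hS
    have hcy : Commute y S := commute_of_mem_centreVN hy hS
    constructor
    · intro h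
      have h3 := Commute.mul_nonneg hy0 h
        (((commute_ringInverse hyu (Commute.refl y)).symm).mul_right hcy)
      rwa [← mul_assoc, h2, one_mul] at h3
    · intro h
      exact Commute.mul_nonneg hi0 h (commute_ringInverse hyu hcy)
  rw [isStrictIn_iff, hreg, hsub, hreg, hmem]
  refine and_congr_right fun hTM => and_congr_left fun _ => ?_
  rw [hnn T hTM, ← sub_nonneg (b := Ring.inverse y * T), hsub, hnn _ (sub_mem hy.1 hTM), sub_nonneg]

end Operators

/-! ### Matrix units from a projection and a symmetry. -/

section MatrixUnits

variable {A Z : Type*} [Ring A] [StarRing A] [Algebra ℂ A]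
  [Ring Z] [StarRing Z] [Algebra ℂ Z]

theorem mul_symmetry_mul_eq_zero {A : Type*} [Ring A] {e V : A} (hV2 : V * V = 1)
    (hee : e * e = e) (heV : V * e * V = 1 - e) : e * V * e = 0 := by
  have : e * V * e = e * (V * e * V) * V := by
    simp only [mul_assoc, hV2, mul_one]
  rw [this, heV, mul_sub, mul_one, hee, sub_self, zero_mul]

/-- A projection `e` and a symmetry `V` exchanging `e` and `1 - e` give a system of `2 × 2` matrix
units; if the elements commuting with `e` and `V` form a central subalgebra `Z`, then the algebra
is `𝕄₂(Z)`. -/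
noncomputable def matrixUnitsEquiv (ι : Z →⋆ₐ[ℂ] A) (hι : Function.Injective ι)
    (hcen : ∀ z x, Commute (ι z) x) {e V : A} (hes : star e = e) (hVs : star V = V)
    (hee : e * e = e) (hV2 : V * V = 1) (heV : V * e * V = 1 - e)
    (hrange : ∀ x, Commute x e → Commute x V → ∃ z, ι z = x) :
    Matrix (Fin 2) (Fin 2) Z ≃⋆ₐ[ℂ] A :=
  have heVe : e * V * e = 0 := mul_symmetry_mul_eq_zero hV2 hee heV
  StarAlgEquiv.ofBijective
    ({ toFun := fun m => ι (m 0 0) * e + ι (m 0 1) * (e * V) + ι (m 1 0) * (V * e) +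
          ι (m 1 1) * (V * e * V)
       map_one' := by
        simp [heV]
       map_zero' := by simp
       map_add' := fun m n => by
        simp only [Matrix.add_apply, map_add]
        noncomm_ring
       map_mul' := fun m n => by
        have key : ∀ (z w : Z) (x y : A), ι z * x * (ι w * y) = ι (z * w) * (x * y) := by
          intro z w x y
          rw [map_mul, mul_assoc, mul_assoc, ← mul_assoc x, ← (hcen w x).eq, mul_assoc]
        have u11 : e * (V * e * V) = 0 := by
          rw [← mul_assoc, ← mul_assoc, heVe, zero_mul]
        have u1 : e * (e * V) = e * V := by rw [← mul_assoc, hee]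
        have u2 : e * (V * e) = 0 := by rw [← mul_assoc, heVe]
        have u3 : e * V * (e * V) = 0 := by rw [← mul_assoc, heVe, zero_mul]
        have u4 : e * V * (V * e) = e := by
          rw [mul_assoc, ← mul_assoc V, hV2, one_mul, hee]
        have u5 : e * V * (V * e * V) = e * V := by
          rw [← mul_assoc, u4]
        have u6 : V * e * e = V * e := by rw [mul_assoc, hee]
        have u7 : V * e * (e * V) = V * e * V := by rw [← mul_assoc, u6]
        have u8 : V * e * (V * e) = 0 := by rw [mul_assoc, u2, mul_zero]
        have u9 : V * e * (V * e * V) = 0 := by rw [← mul_assoc, u8, zero_mul]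
        have v1 : V * e * V * e = 0 := by rw [mul_assoc, u8]
        have v2 : V * e * V * (e * V) = 0 := by rw [← mul_assoc, v1, zero_mul]
        have v3 : V * e * V * (V * e) = V * e := by
          rw [mul_assoc, ← mul_assoc V V, hV2, one_mul, u6]
        have v4 : V * e * V * (V * e * V) = V * e * V := by rw [← mul_assoc, v3]
        simp only [Matrix.mul_apply, Fin.sum_univ_two, mul_add, add_mul, key, hee, u1, u2, u3, u4,
          u5, u6, u7, u8, u9, u11, v1, v2, v3, v4, heVe, map_add, mul_zero]
        abel
       commutes' := fun r => by
        simp only [Matrix.algebraMap_matrix_apply, heV]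
        simpa [mul_sub] using AlgHomClass.commutes ι r
       map_star' := fun m => by
        have hs : ∀ (z : Z) (x : A), star (ι z * x) = ι (star z) * star x := by
          intro z x
          rw [star_mul, map_star, ← map_star, (hcen _ _).eq]
        simp only [Matrix.star_apply, star_add, hs, star_mul, hes, hVs, mul_assoc]
        abel } : Matrix (Fin 2) (Fin 2) Z →⋆ₐ[ℂ] A)
    (by
      have heVe' : ∀ x, e * (V * (e * x)) = 0 := by
        intro x; rw [← mul_assoc, ← mul_assoc, heVe, zero_mul]
      have hee' : ∀ x, e * (e * x) = e * x := by
        intro x; rw [← mul_assoc, hee]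
      have hV2' : ∀ x, V * (V * x) = x := by
        intro x; rw [← mul_assoc, hV2, one_mul]
      have heVe0 : e * (V * e) = 0 := by rw [← mul_assoc, heVe]
      have hsum : ∀ x : A, x = e * x * e + e * x * (V * e * V) + V * e * V * x * e +
          V * e * V * x * (V * e * V) := by
        intro x
        rw [heV]
        noncomm_ring
      constructor
      · rw [injective_iff_map_eq_zero]
        intro m hm
        change ι (m 0 0) * e + ι (m 0 1) * (e * V) + ι (m 1 0) * (V * e) +
          ι (m 1 1) * (V * e * V) = 0 at hm
        -- Conjugation by `V` carries `ι z e = 0` to `ι z (1 - e) = 0`.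
        have hinj : ∀ z : Z, ι z * e = 0 → z = 0 := by
          intro z hz
          apply hι
          have h2 : ι z * (V * e * V) = 0 := by
            rw [mul_assoc, ← mul_assoc, (hcen z V).eq, mul_assoc, ← mul_assoc (ι z), hz, zero_mul,
              mul_zero]
          rw [heV, mul_sub, hz, mul_one, sub_zero] at h2
          rw [h2, map_zero]
        have hcomm : ∀ (z : Z) (x y : A), x * (ι z * y) = ι z * (x * y) := by
          intro z x y
          rw [← mul_assoc, ← (hcen z x).eq, mul_assoc]
        have h00 := congrArg (fun x => e * (x * e)) hm
        have h01 := congrArg (fun x => e * (x * (V * e))) hm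
        have h10 := congrArg (fun x => e * (V * x * e)) hm
        have h11 := congrArg (fun x => e * (V * x * (V * e))) hm
        simp only [add_mul, mul_add, hcomm, mul_assoc, hee, heVe0, hV2', mul_zero, zero_mul,
          add_zero, zero_add] at h00 h01 h10 h11
        ext i j
        fin_cases i <;> fin_cases j
        · exact hinj _ h00
        · exact hinj _ h01
        · exact hinj _ h10
        · exact hinj _ h11
      · intro x
        -- Copying the corner `e y e` to the other diagonal block gives an element commuting with
        -- `e` and `V`. The four entries of `x` are moved into that corner by taking `y = x`, `x V`,
        -- `V x`, `V x V`.
        have hz : ∀ y : A, ∃ z, ι z = e * y * e + V * (e * y * e) * V := by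
          intro y
          apply hrange
          · change _ * _ = _ * _
            simp only [add_mul, mul_add, mul_assoc, hee, hee', heVe', heVe0, mul_zero]
          · change _ * _ = _ * _
            simp only [add_mul, mul_add, mul_assoc, hV2, hV2', mul_one]
            abel
        obtain ⟨z00, h00⟩ := hz x
        obtain ⟨z01, h01⟩ := hz (x * V)
        obtain ⟨z10, h10⟩ := hz (V * x)
        obtain ⟨z11, h11⟩ := hz (V * x * V)
        refine ⟨!![z00, z01; z10, z11], ?_⟩
        change ι z00 * e + ι z01 * (e * V) + ι z10 * (V * e) + ι z11 * (V * e * V) = x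
        rw [h00, h01, h10, h11]
        conv_rhs => rw [hsum x]
        simp only [add_mul, mul_assoc, hee, hee', heVe', heVe0, hV2', mul_zero, add_zero, zero_add])

/-- A `2 × 2` matrix algebra has no nonzero element annihilating all commutators. -/
theorem eq_zero_of_mul_commutator_eq_zero {Z : Type*} [Ring Z] {f : Matrix (Fin 2) (Fin 2) Z}
    (h : ∀ x y : Matrix (Fin 2) (Fin 2) Z, f * (x * y) = f * (y * x)) : f = 0 := by
  -- These commutators are the off-diagonal units; right multiplication by them exposes the two
  -- columns of `f`.
  have h1 := h !![1, 0; 0, 0] !![0, 1; 0, 0]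
  have h2 := h !![0, 0; 0, 1] !![0, 0; 1, 0]
  ext i j
  have h1i := congrFun (congrFun h1 i) 1
  have h2i := congrFun (congrFun h2 i) 0
  simp [Matrix.mul_apply, Fin.sum_univ_two] at h1i h2i
  fin_cases j
  · exact h1i
  · exact h2i

end MatrixUnits

/-! ### Two projections in generic position. -/

section TwoProjections

variable {H : Type*} [NormedAddCommGroup H] [InnerProductSpace ℂ H] [CompleteSpace H]

theorem half_smul_nonneg {T : H →L[ℂ] H} (hT : 0 ≤ T) : 0 ≤ (1 / 2 : ℂ) • T := by
  have : (1 / 2 : ℂ) • T = (1 / 2 : ℝ) • T := by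
    rw [← Complex.coe_smul]
    norm_num
  rw [this]
  exact smul_nonneg (by norm_num) hT

/-- For the positive root `r`, `(1 + r)(1 - r) = (1 - t) / 2`, so `1 - r` inherits injectivity from
`1 - t`. -/
theorem exists_strict_sqrt_half {N : VonNeumannAlgebra H} {t : H →L[ℂ] H} (ht : t ∈ N)
    (h0 : 0 ≤ 1 + t) (h1 : 0 ≤ 1 - t) (hr0 : IsLeftRegular (1 + t)) (hr1 : IsLeftRegular (1 - t)) :
    ∃ r, IsStrictIn N r ∧ r * r = (1 / 2 : ℂ) • (1 + t) := by
  have hT0 : 0 ≤ (1 / 2 : ℂ) • (1 + t) := half_smul_nonneg h0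
  have hTN : (1 / 2 : ℂ) • (1 + t) ∈ N := smul_mem_vn _ (add_mem (one_mem N) ht)
  have hsub : 1 - (1 / 2 : ℂ) • (1 + t) = (1 / 2 : ℂ) • (1 - t) := by module
  have hT1 : (1 / 2 : ℂ) • (1 + t) ≤ 1 := by
    rw [← sub_nonneg, hsub]
    exact half_smul_nonneg h1
  have hsq := CFC.sqrt_mul_sqrt_self ((1 / 2 : ℂ) • (1 + t)) hT0
  rw [isLeftRegular_iff_right_eq_zero_of_mul] at hr0 hr1
  refine ⟨CFC.sqrt ((1 / 2 : ℂ) • (1 + t)), isStrictIn_iff.2 ⟨sqrt_mem_vn hT0 hTN,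
    ⟨CFC.sqrt_nonneg _, ?_⟩, ?_, ?_⟩, hsq⟩
  · simpa using CFC.sqrt_le_sqrt _ _ hT1
  · rw [isLeftRegular_iff_right_eq_zero_of_mul]
    intro z hz
    apply hr0
    have : ((1 / 2 : ℂ) • (1 + t)) * z = 0 := by rw [← hsq, mul_assoc, hz, mul_zero]
    rw [smul_mul_assoc] at this
    exact (smul_eq_zero.1 this).resolve_left (by norm_num)
  · rw [isLeftRegular_iff_right_eq_zero_of_mul]
    intro z hz
    apply hr1
    have : ((1 / 2 : ℂ) • (1 - t)) * z = 0 := by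
      rw [← hsub, ← hsq]
      rw [show 1 - CFC.sqrt ((1 / 2 : ℂ) • (1 + t)) * CFC.sqrt ((1 / 2 : ℂ) • (1 + t)) =
        (1 + CFC.sqrt ((1 / 2 : ℂ) • (1 + t))) * (1 - CFC.sqrt ((1 / 2 : ℂ) • (1 + t))) by
          noncomm_ring, mul_assoc, hz, mul_zero]
    rw [smul_mul_assoc] at this
    exact (smul_eq_zero.1 this).resolve_left (by norm_num)

/-- Half-angle elements: `r₁² = (1 + s) / 2`, `r₂² = (1 - s) / 2` and `r₁ r₂ = c / 2`. -/
theorem exists_strict_half_angle {N : VonNeumannAlgebra H} (hN : ∀ x ∈ N, ∀ y ∈ N, Commute x y)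
    {s c : H →L[ℂ] H} (hs : s ∈ N) (hs0 : 0 ≤ s) (hc0 : 0 ≤ c) (hsc1 : s * s + c * c = 1)
    (hc_reg : IsLeftRegular c) :
    ∃ r₁ r₂, IsStrictIn N r₁ ∧ IsStrictIn N r₂ ∧ r₁ * r₁ = (1 / 2 : ℂ) • (1 + s) ∧
      r₂ * r₂ = (1 / 2 : ℂ) • (1 + -s) ∧ r₁ * r₂ = (1 / 2 : ℂ) • c := by
  have hs1 : s ≤ 1 := by
    have h : s * s ≤ 1 := by
      rw [← hsc1]
      have := star_mul_self_nonneg c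
      rw [(IsSelfAdjoint.of_nonneg hc0).star_eq] at this
      exact le_add_of_nonneg_right this
    have h3 := CFC.sqrt_le_sqrt _ _ h
    rwa [CFC.sqrt_mul_self s hs0, CFC.sqrt_one] at h3
  have hreg_add : IsLeftRegular (1 + s) := by
    apply isLeftRegular_add_of_nonneg zero_le_one hs0
    exact isRegular_one.left
  -- Injectivity of `c` enters through `(1 + s)(1 - s) = c²`.
  have hreg_sub : IsLeftRegular (1 - s) := by
    have : IsLeftRegular ((1 + s) * (1 - s)) := by
      rw [show (1 + s) * (1 - s) = c * c by
        linear_combination (norm := noncomm_ring) - hsc1]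
      exact hc_reg.mul hc_reg
    exact this.of_mul
  obtain ⟨r₁, hr₁, hr₁sq⟩ := exists_strict_sqrt_half hs (add_nonneg zero_le_one hs0)
    (sub_nonneg.2 hs1) hreg_add hreg_sub
  obtain ⟨r₂, hr₂, hr₂sq⟩ := exists_strict_sqrt_half (t := -s) (neg_mem hs)
    (by rw [← sub_eq_add_neg]; exact sub_nonneg.2 hs1)
    (by rw [sub_neg_eq_add]; exact add_nonneg zero_le_one hs0)
    (by rw [← sub_eq_add_neg]; exact hreg_sub) (by rw [sub_neg_eq_add]; exact hreg_add)
  have hr₁Z : r₁ ∈ N := hr₁.1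
  have hr₂Z : r₂ ∈ N := hr₂.1
  have hr12 : Commute r₁ r₂ := hN r₁ hr₁Z r₂ hr₂Z
  have hprod : r₁ * r₂ = (1 / 2 : ℂ) • c := by
    -- `r₁ r₂` and `c / 2` are both positive square roots of `(1 - s²) / 4 = c² / 4`, hence equal.
    have h1 : CFC.sqrt ((1 / 4 : ℂ) • (c * c)) = r₁ * r₂ := by
      apply CFC.sqrt_unique _ (Commute.mul_nonneg hr₁.2.1.1 hr₂.2.1.1 hr12)
      calc r₁ * r₂ * (r₁ * r₂) = (r₁ * r₁) * (r₂ * r₂) := by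
            rw [mul_assoc, ← mul_assoc r₂, ← hr12.eq]; simp only [mul_assoc]
        _ = (1 / 4 : ℂ) • (c * c) := by
            rw [hr₁sq, hr₂sq, smul_mul_smul_comm, eq_sub_iff_add_eq'.2 hsc1]
            norm_num
            noncomm_ring
    have h2 : CFC.sqrt ((1 / 4 : ℂ) • (c * c)) = (1 / 2 : ℂ) • c := by
      apply CFC.sqrt_unique _ (half_smul_nonneg hc0)
      rw [smul_mul_smul_comm]
      norm_num
    rw [← h1, h2]
  exact ⟨r₁, r₂, hr₁, hr₂, hr₁sq, hr₂sq, hprod⟩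

/-- The identification given by a projection `e` and a symmetry `V` with `V e V = 1 - e` whose
joint relative commutant is the centre. -/
noncomputable def M2Identification.ofMatrixUnits {M : VonNeumannAlgebra H} {e V : H →L[ℂ] H}
    (heM : e ∈ M) (hVM : V ∈ M) (hes : star e = e) (hVs : star V = V) (hee : e * e = e)
    (hVV : V * V = 1) (heV : V * e * V = 1 - e)
    (hrange : ∀ x ∈ M, Commute x e → Commute x V → x ∈ centreVN M) : M2Identification M where
  K := H
  M₀ := centreVN M
  abelian := fun _ hx _ hy => (commute_of_mem_centreVN hx hy.1).eq
  Φ := (matrixUnitsEquiv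
    (StarSubalgebra.inclusion (inf_le_left : (centreVN M).toStarSubalgebra ≤ M.toStarSubalgebra))
    (StarSubalgebra.inclusion_injective _)
    (fun z x => Subtype.ext (commute_of_mem_centreVN z.2 x.2).eq)
    (e := ⟨e, heM⟩) (V := ⟨V, hVM⟩) (Subtype.ext hes) (Subtype.ext hVs) (Subtype.ext hee)
    (Subtype.ext hVV) (Subtype.ext heV)
    (fun x hxe hxV => ⟨⟨x, hrange x x.2 (congrArg Subtype.val hxe)
      (congrArg Subtype.val hxV)⟩, rfl⟩)).symm

/-- Since `V` exchanges `e` and `1 - e`, it is the sum `e V + V e` of the off-diagonal units, so the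
formula for `p` lists its matrix entries. -/
theorem M2Identification.isM2StrictVia_ofMatrixUnits {M : VonNeumannAlgebra H} {e V : H →L[ℂ] H}
    (heM : e ∈ M) (hVM : V ∈ M) (hes : star e = e) (hVs : star V = V) (hee : e * e = e)
    (hVV : V * V = 1) (heV : V * e * V = 1 - e)
    (hrange : ∀ x ∈ M, Commute x e → Commute x V → x ∈ centreVN M) {p r₁ r₂ : H →L[ℂ] H}
    (hpM : p ∈ M) (hp : IsStarProjection p) (hr₁ : IsStrictIn (centreVN M) r₁)
    (hr₂ : IsStrictIn (centreVN M) r₂) (h1 : r₁ * r₁ + r₂ * r₂ = 1)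
    (hpe : p = r₁ * r₁ * e + r₁ * r₂ * V + r₂ * r₂ * (1 - e)) :
    IsM2StrictVia (ofMatrixUnits heM hVM hes hVs hee hVV heV hrange) p := by
  have hVe : e * V + V * e = V := by
    linear_combination (norm := noncomm_ring) heV * V - V * e * hVV
  have h1' : r₁ ^ 2 + r₂ ^ 2 = 1 := by rw [sq, sq, h1]
  have hpe' : p = r₁ ^ 2 * e + r₁ * r₂ * (e * V) + r₁ * r₂ * (V * e) + r₂ ^ 2 * (V * e * V) := by
    rw [heV, add_assoc (r₁ ^ 2 * e), ← mul_add, hVe, sq, sq, hpe]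
  exact ⟨hp, hpM, ⟨r₁, hr₁.1⟩, ⟨r₂, hr₂.1⟩, hr₁, hr₂, Subtype.ext h1',
    (StarAlgEquiv.symm_apply_eq _).2 (Subtype.ext hpe')⟩

/-- Two projections in generic position generate, over the centre, a `2 × 2` matrix algebra in
which both are `𝕄₂`-strict. -/
theorem exists_M2Identification {M : VonNeumannAlgebra H} {p q : H →L[ℂ] H}
    (hpM : p ∈ M) (hqM : q ∈ M) (hp : IsStarProjection p) (hq : IsStarProjection q)
    (hgen : ∀ x ∈ M, Commute x p → Commute x q → x ∈ M.commutant)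
    (hd : IsLeftRegular (p - q)) (hg : IsLeftRegular (p + q - 1)) :
    ∃ F : M2Identification M, IsM2StrictVia F p ∧ IsM2StrictVia F q := by
  have hpp : p * p = p := hp.isIdempotentElem
  have hqq : q * q = q := hq.isIdempotentElem
  have hdM : p - q ∈ M := sub_mem hpM hqM
  have hgM : p + q - 1 ∈ M := sub_mem (add_mem hpM hqM) (one_mem M)
  have hds : IsSelfAdjoint (p - q) := hp.isSelfAdjoint.sub hq.isSelfAdjoint
  have hgs : IsSelfAdjoint (p + q - 1) :=
    (hp.isSelfAdjoint.add hq.isSelfAdjoint).sub (IsSelfAdjoint.one _)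
  obtain ⟨e, heM, he, hde⟩ := exists_projection_sign hdM hds
  obtain ⟨v, hvM, hv, hgv⟩ := exists_projection_sign hgM hgs
  have hss : CFC.abs (p - q) * CFC.abs (p - q) = (p - q) * (p - q) := by
    rw [CFC.abs_mul_abs, hds.star_eq]
  have hcc : CFC.abs (p + q - 1) * CFC.abs (p + q - 1) = (p + q - 1) * (p + q - 1) := by
    rw [CFC.abs_mul_abs, hgs.star_eq]
  -- `|d|` is the root of `d²`, so it commutes with `p` and `q` when `d²` does, and `hgen` makes it
  -- central.
  have habsc : ∀ d : H →L[ℂ] H, d ∈ M → IsSelfAdjoint d → Commute (d * d) p →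
      Commute (d * d) q → CFC.abs d ∈ centreVN M := by
    intro d hd hds h1 h2
    refine ⟨abs_mem_vn hd, hgen _ (abs_mem_vn hd) ?_ ?_⟩
    · apply commute_sqrt (star_mul_self_nonneg d); rwa [hds.star_eq]
    · apply commute_sqrt (star_mul_self_nonneg d); rwa [hds.star_eq]
  have hsZ : CFC.abs (p - q) ∈ centreVN M := by
    apply habsc _ hdM hds
    · change _ * _ = _ * _
      linear_combination (norm := noncomm_ring) hpp * p - q * hpp + hqq * p - p * hqq - p * hpp
        + hpp * q
    · change _ * _ = _ * _
      linear_combination (norm := noncomm_ring) hpp * q - q * hpp - p * hqq + hqq * p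
  have hcZ : CFC.abs (p + q - 1) ∈ centreVN M := by
    apply habsc _ hgM hgs
    · change _ * _ = _ * _
      linear_combination (norm := noncomm_ring) q * hpp - hpp * q + hqq * p - p * hqq
    · change _ * _ = _ * _
      linear_combination (norm := noncomm_ring) hpp * q - q * hpp + p * hqq - hqq * p
  have hs0 := CFC.abs_nonneg (p - q)
  have hc0 := CFC.abs_nonneg (p + q - 1)
  have hdg : (p - q) * (p + q - 1) + (p + q - 1) * (p - q) = 0 := by
    linear_combination (norm := noncomm_ring) 2 * hpp - 2 * hqq
  have hsc1 : (p - q) * (p - q) + (p + q - 1) * (p + q - 1) = 1 := by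
    linear_combination (norm := noncomm_ring) 2 * hpp + 2 * hqq
  rw [← hss, ← hcc] at hsc1
  have hpdg : p = (1 / 2 : ℂ) • (1 + (p + q - 1) + (p - q)) := by module
  have hqdg : q = (1 / 2 : ℂ) • (1 + (p + q - 1) - (p - q)) := by module
  generalize hs_def : CFC.abs (p - q) = s at *
  generalize hc_def : CFC.abs (p + q - 1) = c at *
  generalize hV_def : 2 * v - 1 = V at *
  have hVM : V ∈ M := by
    rw [← hV_def, two_mul]
    exact sub_mem (add_mem hvM hvM) (one_mem M)
  have hVV : V * V = 1 := by
    have hvv : v * v = v := hv.isIdempotentElem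
    rw [← hV_def]
    linear_combination (norm := noncomm_ring) 4 * hvv
  have hVs : star V = V := by
    rw [← hV_def, two_mul, star_sub, star_add, hv.isSelfAdjoint.star_eq, star_one]
  have hee : e * e = e := he.isIdempotentElem
  have hes : star e = e := he.isSelfAdjoint.star_eq
  have hs_reg : IsLeftRegular s := by rw [hde] at hd; exact hd.of_mul
  have hc_reg : IsLeftRegular c := by rw [hgv] at hg; exact hg.of_mul
  have hsV : Commute s V := commute_of_mem_centreVN hsZ hVM
  have hse : Commute s e := commute_of_mem_centreVN hsZ heM
  have hcV : Commute c V := commute_of_mem_centreVN hcZ hVM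
  have hce : Commute c e := commute_of_mem_centreVN hcZ heM
  have hsc : Commute s c := commute_of_mem_centreVN hsZ hcZ.1
  -- The central injective `s` and `c` can be cancelled from `d g + g d = 0`, so the signs
  -- anticommute as well.
  have hanti : (2 * e - 1) * V + V * (2 * e - 1) = 0 := by
    rw [hde, hgv] at hdg
    have h2e : ∀ x : H →L[ℂ] H, Commute x e → Commute x (2 * e - 1) := fun x hx => by
      rw [two_mul]
      exact (hx.add_right hx).sub_right (Commute.one_right x)
    have h1 : s * (c * ((2 * e - 1) * V + V * (2 * e - 1))) = 0 := by
      rw [← hdg, mul_add, mul_add]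
      congr 1
      · calc s * (c * ((2 * e - 1) * V)) = s * ((2 * e - 1) * (c * V)) := by
              rw [← mul_assoc c, (h2e c hce).eq, mul_assoc]
          _ = (2 * e - 1) * s * (V * c) := by
              rw [hcV.eq, ← mul_assoc, (h2e s hse).eq]
      · calc s * (c * (V * (2 * e - 1))) = c * s * (V * (2 * e - 1)) := by
              rw [← mul_assoc, hsc.eq]
          _ = c * (s * V * (2 * e - 1)) := by simp only [mul_assoc]
          _ = c * V * (s * (2 * e - 1)) := by rw [hsV.eq]; simp only [mul_assoc]
          _ = V * c * ((2 * e - 1) * s) := by rw [hcV.eq, (h2e s hse).eq]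
    rw [isLeftRegular_iff_right_eq_zero_of_mul] at hs_reg hc_reg
    exact hc_reg _ (hs_reg _ h1)
  have heV : V * e * V = 1 - e := by
    have h2 : (2 : ℂ) • (V * e * V - (1 - e)) = 0 := by
      rw [two_smul]
      linear_combination (norm := noncomm_ring) hanti * V + 2 * hVV - 2 * e * hVV
    exact sub_eq_zero.1 ((smul_eq_zero.1 h2).resolve_left two_ne_zero)
  have hrange : ∀ x ∈ M, Commute x e → Commute x V → x ∈ centreVN M := by
    intro x hx hxe hxV
    have hxs : Commute x s := (commute_of_mem_centreVN hsZ hx).symm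
    have hxc : Commute x c := (commute_of_mem_centreVN hcZ hx).symm
    have hxg : Commute x (p + q - 1) := by rw [hgv]; exact hxV.mul_right hxc
    have hxd : Commute x (p - q) := by
      rw [hde, two_mul]
      exact ((hxe.add_right hxe).sub_right (Commute.one_right x)).mul_right hxs
    refine ⟨hx, hgen x hx ?_ ?_⟩
    · rw [hpdg]
      exact (((Commute.one_right x).add_right hxg).add_right hxd).smul_right _
    · rw [hqdg]
      exact (((Commute.one_right x).add_right hxg).sub_right hxd).smul_right _
  obtain ⟨r₁, r₂, hr₁, hr₂, hr₁sq, hr₂sq, hprod⟩ := exists_strict_half_angle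
    (fun x hx y hy => commute_of_mem_centreVN hx hy.1) hsZ hs0 hc0 hsc1 hc_reg
  have hsum : r₁ * r₁ + r₂ * r₂ = 1 := by
    rw [hr₁sq, hr₂sq]
    module
  have hr21 : r₂ * r₁ = (1 / 2 : ℂ) • c := by
    rw [← hprod, (commute_of_mem_centreVN hr₁.1 hr₂.1.1).eq]
  have hse' : s * e = (1 / 2 : ℂ) • (p - q + s) := by
    rw [hde, sub_mul, one_mul, two_mul, add_mul, ← hse.eq]
    module
  have hcV' : c * V = p + q - 1 := by rw [hgv, hcV.eq]
  -- `p = (1 + g + d) / 2` with `d = (2e - 1) s` and `g = V c` has diagonal entries `(1 ± s) / 2`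
  -- and off-diagonal entry `c / 2`. Passing to `q` changes the sign of `d`, which swaps `r₁` and
  -- `r₂`.
  refine ⟨M2Identification.ofMatrixUnits heM hVM hes hVs hee hVV heV hrange,
    M2Identification.isM2StrictVia_ofMatrixUnits heM hVM hes hVs hee hVV heV hrange hpM hp hr₁ hr₂
      hsum ?_,
    M2Identification.isM2StrictVia_ofMatrixUnits heM hVM hes hVs hee hVV heV hrange hqM hq hr₂ hr₁
      (by rw [add_comm, hsum]) ?_⟩
  · rw [hprod, hr₁sq, hr₂sq, smul_mul_assoc, smul_mul_assoc, smul_mul_assoc, hcV', add_mul,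
      one_mul, mul_sub, mul_one, add_mul, one_mul, neg_mul, hse']
    module
  · rw [hr21, hr₁sq, hr₂sq, smul_mul_assoc, smul_mul_assoc, smul_mul_assoc, hcV', add_mul,
      one_mul, mul_sub, mul_one, add_mul, one_mul, neg_mul, hse']
    module

end TwoProjections

/-! ### The decomposition and its converse. -/

section Decomposition

/-- If `w z = 0`, then `β s z = k' s w z + s' s z = 0`, so `s z = 0`; hence `α z = 0` and `z = 0`.
-/
theorem isLeftRegular_of_complementary {R : Type*} [Ring R] {α β w k k' s s' : R}
    (hα : IsLeftRegular α) (hβ : IsLeftRegular β) (hα' : α = k * w + s) (hβ' : β = k' * w + s')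
    (hw : Commute w s) (hs : s' * s = 0) : IsLeftRegular w := by
  rw [isLeftRegular_iff_right_eq_zero_of_mul] at *
  intro z hz
  have h1 : s * z = 0 := by
    apply hβ
    rw [hβ', add_mul, ← mul_assoc s', hs, zero_mul, add_zero, mul_assoc, ← mul_assoc w, hw.eq,
      mul_assoc, hz, mul_zero, mul_zero]
  apply hα
  rw [hα', add_mul, h1, mul_assoc, hz, mul_zero, add_zero]

/-- If `p z = q z`, this common value lies in both ranges, so `h'` makes it zero; then `z` lies in
both kernels and `h` makes it zero. -/
theorem isLeftRegular_sub_of_generic {R : Type*} [Ring R] {p q w₁ w₂ : R}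
    (hp : p * p = p) (hq : q * q = q) (h : IsLeftRegular (w₁ * p + w₂ * q))
    (h' : IsLeftRegular (w₁ * (1 - p) + w₂ * (1 - q))) : IsLeftRegular (p - q) := by
  rw [isLeftRegular_iff_right_eq_zero_of_mul] at *
  intro z hz
  have hpq : p * z = q * z := by rwa [sub_mul, sub_eq_zero] at hz
  have hpz : p * z = 0 := by
    apply h'
    linear_combination (norm := noncomm_ring) -w₁ * hp * z + w₂ * (1 - q) * hpq - w₂ * hq * z
  apply h
  linear_combination (norm := noncomm_ring) w₁ * hpz + w₂ * hpz - w₂ * hpq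

variable {H : Type*} [NormedAddCommGroup H] [InnerProductSpace ℂ H] [CompleteSpace H]

theorem le_one_of_norm_lt_one {x : H →L[ℂ] H} (h0 : 0 ≤ x) (h : ‖x‖ < 1) : x ≤ 1 :=
  (CStarAlgebra.norm_le_one_iff_of_nonneg x h0).1 h.le

theorem exists_isRelDecomposition {a b x₀ : H →L[ℂ] H} (ha : IsSelfAdjoint a)
    (hb : IsSelfAdjoint b) (hx0 : 0 ≤ x₀) (hxZ : x₀ ∈ centreVN (generatedVN {a, b}))
    (hxn : ‖x₀‖ < 1) (habs : CFC.abs (a - b) + CFC.abs (1 - a - b) = 1 - x₀)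
    (hsa : IsRelStrictIn (generatedVN {a, b}) x₀ a)
    (hsb : IsRelStrictIn (generatedVN {a, b}) x₀ b) :
    ∃ (F : M2Identification (generatedVN {a, b})) (p q w₁ w₂ : H →L[ℂ] H),
      IsM2StrictVia F p ∧ IsM2StrictVia F q ∧
      IsRelDecomposition (generatedVN {a, b}) x₀ a b p q w₁ w₂ := by
  have haM : a ∈ generatedVN {a, b} := subset_generatedVN _ (Or.inl rfl)
  have hbM : b ∈ generatedVN {a, b} := subset_generatedVN _ (Or.inr rfl)
  have hcomm : ∀ z, Commute z a → Commute z b → z ∈ (generatedVN {a, b}).commutant :=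
    fun z => mem_commutant_of_commute_pair ha hb
  generalize generatedVN {a, b} = M at *
  have hx1 : x₀ ≤ 1 := le_one_of_norm_lt_one hx0 hxn
  have hy0 : 0 ≤ 1 - x₀ := sub_nonneg.2 hx1
  have hyZ : 1 - x₀ ∈ centreVN M := sub_mem (one_mem _) hxZ
  have hyu : IsUnit (1 - x₀) := isUnit_one_sub_of_norm_lt_one hxn
  obtain ⟨-, -, hTa, hTa'⟩ := (isStrictIn_ringInverse_mul_iff hy0 hyZ hyu).1 hsa
  obtain ⟨-, -, hTb, hTb'⟩ := (isStrictIn_ringInverse_mul_iff hy0 hyZ hyu).1 hsb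
  have hneg : CFC.abs (1 - a - b) = CFC.abs (a + b - 1) := by
    rw [← CFC.abs_neg (a + b - 1)]
    congr 1
    abel
  rw [hneg] at habs
  have huM : a - b ∈ M := sub_mem haM hbM
  have hvM : a + b - 1 ∈ M := sub_mem (add_mem haM hbM) (one_mem M)
  have hus : IsSelfAdjoint (a - b) := ha.sub hb
  have hvs : IsSelfAdjoint (a + b - 1) := (ha.add hb).sub (IsSelfAdjoint.one _)
  obtain ⟨q, hqM, hq, huq⟩ := exists_projection_sign huM hus
  obtain ⟨p, hpM, hp, hvp⟩ := exists_projection_sign hvM hvs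
  have hw₂M := abs_mem_vn huM
  have hw₁M := abs_mem_vn hvM
  have hw₂0 := CFC.abs_nonneg (a - b)
  have hw₁0 := CFC.abs_nonneg (a + b - 1)
  have hcu : Commute (CFC.abs (a - b)) (a - b) := CFC.commute_abs_self _ hus.isStarNormal
  have hcv : Commute (CFC.abs (a + b - 1)) (a + b - 1) := CFC.commute_abs_self _ hvs.isStarNormal
  have ha' : a = (1 / 2 : ℂ) • (1 + (a - b) + (a + b - 1)) := by module
  have hb' : b = (1 / 2 : ℂ) • (1 - (a - b) + (a + b - 1)) := by module
  generalize CFC.abs (a - b) = w₂ at *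
  generalize CFC.abs (a + b - 1) = w₁ at *
  have hsum : w₁ + w₂ = 1 - x₀ := by rw [add_comm, habs]
  have hcentral : ∀ w ∈ M, Commute w (a - b) → Commute w (a + b - 1) → w ∈ centreVN M := by
    intro w hw h1 h2
    refine ⟨hw, hcomm w ?_ ?_⟩
    · rw [ha']
      exact (((Commute.one_right w).add_right h1).add_right h2).smul_right _
    · rw [hb']
      exact (((Commute.one_right w).sub_right h1).add_right h2).smul_right _
  -- Commutation with `a + b - 1` comes from `w₂ = (1 - x₀) - w₁`.
  have hw₂Z : w₂ ∈ centreVN M := by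
    refine hcentral w₂ hw₂M hcu ?_
    rw [eq_sub_iff_add_eq.2 habs]
    exact (commute_of_mem_centreVN hyZ hvM).sub_left hcv
  have hw₁Z : w₁ ∈ centreVN M := by
    rw [eq_sub_iff_add_eq.2 hsum]
    exact sub_mem hyZ hw₂Z
  have hpp : p * p = p := hp.isIdempotentElem
  have hqq : q * q = q := hq.isIdempotentElem
  have hw₁ : ∀ x ∈ M, x * w₁ = w₁ * x := fun x hx => (commute_of_mem_centreVN hw₁Z hx).eq.symm
  have hw₂ : ∀ x ∈ M, x * w₂ = w₂ * x := fun x hx => (commute_of_mem_centreVN hw₂Z hx).eq.symm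
  have hp'M : 1 - p ∈ M := sub_mem (one_mem M) hpM
  have hq'M : 1 - q ∈ M := sub_mem (one_mem M) hqM
  rw [sub_mul, one_mul, two_mul, add_mul, hw₂ q hqM] at huq
  rw [sub_mul, one_mul, two_mul, add_mul, hw₁ p hpM] at hvp
  have hTaeq : a - (1 / 2 : ℂ) • x₀ = w₁ * p + w₂ * q := by
    have : a - (1 / 2 : ℂ) • x₀ = (1 / 2 : ℂ) • ((a - b) + (a + b - 1) + (1 - x₀)) := by module
    rw [this, huq, hvp, ← hsum]
    module
  have hTbeq : b - (1 / 2 : ℂ) • x₀ = w₁ * p + w₂ * (1 - q) := by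
    have : b - (1 / 2 : ℂ) • x₀ = (1 / 2 : ℂ) • (-(a - b) + (a + b - 1) + (1 - x₀)) := by module
    rw [this, huq, hvp, ← hsum, mul_sub, mul_one]
    module
  have hTaeq' : 1 - x₀ - (a - (1 / 2 : ℂ) • x₀) = w₁ * (1 - p) + w₂ * (1 - q) := by
    rw [hTaeq, ← hsum]
    noncomm_ring
  have hTbeq' : 1 - x₀ - (b - (1 / 2 : ℂ) • x₀) = w₁ * (1 - p) + w₂ * q := by
    rw [hTbeq, ← hsum]
    noncomm_ring
  rw [hTaeq'] at hTa'
  rw [hTbeq'] at hTb'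
  rw [hTaeq] at hTa
  rw [hTbeq] at hTb
  have hcompl : ∀ w ∈ centreVN M, ∀ r ∈ M, r * r = r → w * (1 - r) * (w * r) = 0 := by
    intro w hw r hr hrr
    rw [mul_assoc, ← mul_assoc _ w, ← (commute_of_mem_centreVN hw (sub_mem (one_mem M) hr)).eq,
      mul_assoc, sub_mul, one_mul, hrr, sub_self, mul_zero, mul_zero]
  have hw₂r : IsLeftRegular w₂ :=
    isLeftRegular_of_complementary hTa hTa' (k := q) (k' := 1 - q) (s := w₁ * p)
      (s' := w₁ * (1 - p)) (by rw [hw₂ q hqM, add_comm]) (by rw [hw₂ _ hq'M, add_comm])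
      (commute_of_mem_centreVN hw₂Z (mul_mem hw₁M hpM)) (hcompl w₁ hw₁Z p hpM hpp)
  have hw₁r : IsLeftRegular w₁ :=
    isLeftRegular_of_complementary hTa hTb (k := p) (k' := p) (s := w₂ * q)
      (s' := w₂ * (1 - q)) (by rw [hw₁ p hpM]) (by rw [hw₁ p hpM])
      (commute_of_mem_centreVN hw₁Z (mul_mem hw₂M hqM)) (hcompl w₂ hw₂Z q hqM hqq)
  have hq'q' : (1 - q) * (1 - q) = 1 - q := hq.one_sub.isIdempotentElem
  have hd : IsLeftRegular (p - q) := isLeftRegular_sub_of_generic hpp hqq hTa hTa'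
  have hg : IsLeftRegular (p + q - 1) := by
    rw [show p + q - 1 = p - (1 - q) by abel]
    exact isLeftRegular_sub_of_generic hpp hq'q' hTb (by rwa [sub_sub_cancel])
  have haeq : a = x₀ * ((1 / 2 : ℂ) • (1 : H →L[ℂ] H)) + w₁ * p + w₂ * q := by
    rw [mul_smul_comm, mul_one, add_assoc, ← hTaeq, add_sub_cancel]
  have hbeq : b = x₀ * ((1 / 2 : ℂ) • (1 : H →L[ℂ] H)) + w₁ * p + w₂ * (1 - q) := by
    rw [mul_smul_comm, mul_one, add_assoc, ← hTbeq, add_sub_cancel]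
  have hgen : ∀ x ∈ M, Commute x p → Commute x q → x ∈ M.commutant := by
    intro x hx hxp hxq
    have hx0 : Commute x (x₀ * ((1 / 2 : ℂ) • (1 : H →L[ℂ] H))) :=
      (commute_of_mem_centreVN hxZ hx).symm.mul_right ((Commute.one_right x).smul_right _)
    have hx1 : Commute x (w₁ * p) := (commute_of_mem_centreVN hw₁Z hx).symm.mul_right hxp
    have hx2 : Commute x w₂ := (commute_of_mem_centreVN hw₂Z hx).symm
    refine hcomm x ?_ ?_
    · rw [haeq]
      exact (hx0.add_right hx1).add_right (hx2.mul_right hxq)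
    · rw [hbeq]
      exact (hx0.add_right hx1).add_right (hx2.mul_right ((Commute.one_right x).sub_right hxq))
  obtain ⟨F, hFp, hFq⟩ := exists_M2Identification hpM hqM hp hq hgen hd hg
  have hstrict : ∀ w w' : H →L[ℂ] H, w ∈ M → 0 ≤ w → 0 ≤ w' → IsLeftRegular w →
      IsLeftRegular w' → w + w' = 1 - x₀ → IsStrictIn M w := by
    intro w w' hwM hw0 hw'0 hwr hw'r hww'
    -- The other weight makes `1 - w` injective: it is `w'` plus a positive operator.
    have h1 : 1 - w = w' + x₀ := by
      rw [eq_sub_iff_add_eq] at hww'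
      rw [← hww']
      abel
    refine isStrictIn_iff.2 ⟨hwM, ⟨hw0, ?_⟩, hwr, ?_⟩
    · rw [← sub_nonneg, h1]
      exact add_nonneg hw'0 hx0
    · rw [h1]
      exact isLeftRegular_add_of_nonneg hw'0 hx0 hw'r
  exact ⟨F, p, q, w₁, w₂, hFp, hFq, ⟨hw₁0, hw₁Z, hstrict w₁ w₂ hw₁M hw₁0 hw₂0 hw₁r hw₂r hsum⟩,
    ⟨hw₂0, hw₂Z, hstrict w₂ w₁ hw₂M hw₂0 hw₁0 hw₂r hw₁r habs⟩, hsum, haeq, hbeq⟩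

/-- An element annihilating all commutators of an algebra isomorphic to `𝕄₂(M₀)` is zero. -/
theorem M2Identification.eq_zero_of_mul_comm {M : VonNeumannAlgebra H} (F : M2Identification M)
    {e : H →L[ℂ] H} (he : e ∈ M) (h : ∀ x ∈ M, ∀ y ∈ M, e * (x * y) = e * (y * x)) : e = 0 := by
  have h1 : F.Φ ⟨e, he⟩ = 0 := by
    apply eq_zero_of_mul_commutator_eq_zero
    intro x y
    have hxy : (⟨e, he⟩ : M.toStarSubalgebra) * (F.Φ.symm x * F.Φ.symm y) =
        ⟨e, he⟩ * (F.Φ.symm y * F.Φ.symm x) :=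
      Subtype.ext (h _ (F.Φ.symm x).2 _ (F.Φ.symm y).2)
    simpa only [map_mul, StarAlgEquiv.apply_symm_apply] using congrArg F.Φ hxy
  have h2 : (⟨e, he⟩ : M.toStarSubalgebra) = 0 := by
    rw [← F.Φ.symm_apply_apply ⟨e, he⟩, h1, map_zero]
  exact congrArg Subtype.val h2

/-- If `P`, `Q` generate, together with the centre, an algebra isomorphic to `𝕄₂(M₀)`, then
`P` and `Q` have no common kernel. -/
theorem isLeftRegular_of_M2Identification {a b w₁ w₂ P Q k₁ k₂ k₃ l₁ l₂ l₃ : H →L[ℂ] H}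
    (ha : IsSelfAdjoint a) (hb : IsSelfAdjoint b) (F : M2Identification (generatedVN {a, b}))
    (hP : IsStarProjection P) (hQ : IsStarProjection Q)
    (hPM : P ∈ generatedVN {a, b}) (hQM : Q ∈ generatedVN {a, b})
    (hw₁ : w₁ ∈ centreVN (generatedVN {a, b})) (hw₂ : w₂ ∈ centreVN (generatedVN {a, b}))
    (hw₁0 : 0 ≤ w₁) (hw₂0 : 0 ≤ w₂) (hw₁r : IsLeftRegular w₁) (hw₂r : IsLeftRegular w₂)
    (hk₁ : k₁ ∈ centreVN (generatedVN {a, b})) (hl₁ : l₁ ∈ centreVN (generatedVN {a, b}))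
    (hk₂ : k₂ ∈ centreVN (generatedVN {a, b})) (hl₂ : l₂ ∈ centreVN (generatedVN {a, b}))
    (hk₃ : k₃ ∈ centreVN (generatedVN {a, b})) (hl₃ : l₃ ∈ centreVN (generatedVN {a, b}))
    (haeq : a = k₁ + k₂ * P + k₃ * Q) (hbeq : b = l₁ + l₂ * P + l₃ * Q) :
    IsLeftRegular (w₁ * P + w₂ * Q) := by
  have hcomm : ∀ z, Commute z a → Commute z b → z ∈ (generatedVN {a, b}).commutant :=
    fun z => mem_commutant_of_commute_pair ha hb
  generalize generatedVN {a, b} = M at *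
  obtain ⟨e, heM, he, hTe, hz⟩ :=
    exists_kernel_projection (add_mem (mul_mem hw₁.1 hPM) (mul_mem hw₂.1 hQM))
  have hS0 : 0 ≤ w₁ * P := Commute.mul_nonneg hw₁0 hP.nonneg (commute_of_mem_centreVN hw₁ hPM)
  have hT0 : 0 ≤ w₂ * Q := Commute.mul_nonneg hw₂0 hQ.nonneg (commute_of_mem_centreVN hw₂ hQM)
  rw [isLeftRegular_iff_right_eq_zero_of_mul] at hw₁r hw₂r
  have hPe : P * e = 0 := by
    apply hw₁r
    rw [← mul_assoc]
    exact mul_eq_zero_of_add_mul_eq_zero hS0 hT0 hTe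
  have hQe : Q * e = 0 := by
    apply hw₂r
    rw [← mul_assoc]
    exact mul_eq_zero_of_add_mul_eq_zero hT0 hS0 (by rw [add_comm, hTe])
  have hadj : ∀ R : H →L[ℂ] H, IsStarProjection R → R * e = 0 → e * R = 0 := by
    intro R hR h
    have := congrArg star h
    simpa [star_mul, hR.isSelfAdjoint.star_eq, he.isSelfAdjoint.star_eq] using this
  have heP := hadj P hP hPe
  have heQ := hadj Q hQ hQe
  have key : ∀ m₁ m₂ m₃ : H →L[ℂ] H, m₁ ∈ centreVN M → m₂ ∈ centreVN M → m₃ ∈ centreVN M →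
      (m₁ + m₂ * P + m₃ * Q) * e = m₁ * e ∧ e * (m₁ + m₂ * P + m₃ * Q) = m₁ * e := by
    intro m₁ m₂ m₃ h1 h2 h3
    have hl : (m₁ + m₂ * P + m₃ * Q) * e = m₁ * e := by
      rw [add_mul, add_mul, mul_assoc, mul_assoc, hPe, hQe, mul_zero, mul_zero, add_zero, add_zero]
    have hr : e * (m₁ + m₂ * P + m₃ * Q) = m₁ * e := by
      rw [mul_add, mul_add, ← mul_assoc, ← mul_assoc, ← (commute_of_mem_centreVN h2 heM).eq,
        ← (commute_of_mem_centreVN h3 heM).eq, mul_assoc, mul_assoc, heP, heQ, mul_zero, mul_zero,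
        add_zero, add_zero, (commute_of_mem_centreVN h1 heM).eq]
    exact ⟨hl, hr⟩
  have ka := key k₁ k₂ k₃ hk₁ hk₂ hk₃
  have kb := key l₁ l₂ l₃ hl₁ hl₂ hl₃
  rw [← haeq] at ka
  rw [← hbeq] at kb
  have heC : e ∈ M.commutant := hcomm e (ka.2.trans ka.1.symm) (kb.2.trans kb.1.symm)
  -- On `e`, the generators `a` and `b` act as the central `k₁` and `l₁`. So all of `e M` is central
  -- and `e` annihilates every commutator.
  have hex : ∀ x ∈ M, e * x ∈ M.commutant := by
    intro x hx
    have hxe : x * e = e * x := (commute_of_mem_commutant hx heC).eq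
    have h : ∀ c m : H →L[ℂ] H, m ∈ centreVN M → c * e = m * e → e * c = m * e →
        Commute (e * x) c := by
      intro c m hm h1 h2
      change e * x * c = c * (e * x)
      rw [← hxe, mul_assoc, h2, hxe, ← mul_assoc c, h1, mul_assoc, ← hxe, ← mul_assoc,
        ← (commute_of_mem_centreVN hm hx).eq, mul_assoc]
    exact hcomm _ (h a k₁ hk₁ ka.1 ka.2) (h b l₁ hl₁ kb.1 kb.2)
  have he0 : e = 0 := by
    apply F.eq_zero_of_mul_comm heM
    intro x hx y hy
    rw [← mul_assoc, ← (commute_of_mem_commutant hy (hex x hx)).eq, ← mul_assoc,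
      (commute_of_mem_commutant hy heC).eq, mul_assoc]
  rw [isLeftRegular_iff_right_eq_zero_of_mul]
  intro z hTz
  rw [← hz z hTz, he0, zero_mul]

theorem isCompatibleRel_of_isRelDecomposition {a b x₀ p q w₁ w₂ : H →L[ℂ] H}
    (ha : IsSelfAdjoint a) (hb : IsSelfAdjoint b) (hx0 : 0 ≤ x₀)
    (hxZ : x₀ ∈ centreVN (generatedVN {a, b})) (hxn : ‖x₀‖ < 1)
    (F : M2Identification (generatedVN {a, b})) (hp : IsStarProjection p)
    (hq : IsStarProjection q) (hpM : p ∈ generatedVN {a, b}) (hqM : q ∈ generatedVN {a, b})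
    (h : IsRelDecomposition (generatedVN {a, b}) x₀ a b p q w₁ w₂) :
    IsCompatibleRel x₀ a b ∧ IsRelStrictIn (generatedVN {a, b}) x₀ a ∧
      IsRelStrictIn (generatedVN {a, b}) x₀ b := by
  obtain ⟨⟨hw₁0, hw₁Z, hw₁s⟩, ⟨hw₂0, hw₂Z, hw₂s⟩, hsum, haeq, hbeq⟩ := h
  rw [mem_vnCentre] at hw₁Z hw₂Z
  have hw₁r := (isStrictIn_iff.1 hw₁s).2.2.1
  have hw₂r := (isStrictIn_iff.1 hw₂s).2.2.1
  rw [mul_smul_comm, mul_one] at haeq hbeq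
  have hx1 : x₀ ≤ 1 := le_one_of_norm_lt_one hx0 hxn
  have hx : x₀ = 1 - w₁ - w₂ := by
    rw [eq_sub_iff_add_eq] at hsum
    rw [← hsum]
    abel
  have hhZ : (1 / 2 : ℂ) • x₀ ∈ centreVN (generatedVN {a, b}) := smul_mem_vn _ hxZ
  refine ⟨⟨⟨hx0, hx1⟩, hxZ, hxn, ?_⟩, ?_⟩
  · have h1 : a - b = w₂ * (2 * q - 1) := by
      rw [haeq, hbeq]
      noncomm_ring
    have h2 : 1 - a - b = -(w₁ * (2 * p - 1)) := by
      have : 1 - a - b = 1 - (1 / 2 : ℂ) • x₀ - (1 / 2 : ℂ) • x₀ - 2 • (w₁ * p) - w₂ := by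
        rw [haeq, hbeq]
        noncomm_ring
      rw [this, sub_sub (1 : H →L[ℂ] H), ← add_smul, hx]
      norm_num
      noncomm_ring
    rw [h1, h2, CFC.abs_neg, abs_symmetry_mul hw₂0 hq (commute_of_mem_centreVN hw₂Z hqM),
      abs_symmetry_mul hw₁0 hp (commute_of_mem_centreVN hw₁Z hpM), add_comm, hsum]
  · have hcorner : ∀ P Q : H →L[ℂ] H, (P = p ∨ P = 1 - p) → (Q = q ∨ Q = 1 - q) →
        0 ≤ w₁ * P + w₂ * Q ∧ IsLeftRegular (w₁ * P + w₂ * Q) := by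
      intro P Q hPp hQq
      have hP : IsStarProjection P := by
        rcases hPp with rfl | rfl
        exacts [hp, hp.one_sub]
      have hQ : IsStarProjection Q := by
        rcases hQq with rfl | rfl
        exacts [hq, hq.one_sub]
      have hPM : P ∈ generatedVN {a, b} := by
        rcases hPp with rfl | rfl
        exacts [hpM, sub_mem (one_mem _) hpM]
      have hQM : Q ∈ generatedVN {a, b} := by
        rcases hQq with rfl | rfl
        exacts [hqM, sub_mem (one_mem _) hqM]
      have hP' : ∃ m ∈ centreVN (generatedVN {a, b}), ∃ n ∈ centreVN (generatedVN {a, b}),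
          w₁ * p = m + n * P := by
        rcases hPp with rfl | rfl
        · exact ⟨0, zero_mem _, w₁, hw₁Z, by rw [zero_add]⟩
        · exact ⟨w₁, hw₁Z, -w₁, neg_mem hw₁Z, by noncomm_ring⟩
      have hQ' : ∃ m ∈ centreVN (generatedVN {a, b}), ∃ n ∈ centreVN (generatedVN {a, b}),
          w₂ * q = m + n * Q := by
        rcases hQq with rfl | rfl
        · exact ⟨0, zero_mem _, w₂, hw₂Z, by rw [zero_add]⟩
        · exact ⟨w₂, hw₂Z, -w₂, neg_mem hw₂Z, by noncomm_ring⟩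
      obtain ⟨m, hm, n, hn, hmn⟩ := hP'
      obtain ⟨m', hm', n', hn', hmn'⟩ := hQ'
      constructor
      · exact add_nonneg
          (Commute.mul_nonneg hw₁0 hP.nonneg (commute_of_mem_centreVN hw₁Z hPM))
          (Commute.mul_nonneg hw₂0 hQ.nonneg (commute_of_mem_centreVN hw₂Z hQM))
      -- The constants result from substituting `w₁ p = m + n P` and `w₂ q = m' + n' Q`; in `b` the
      -- last term is `w₂ - w₂ q`.
      · refine isLeftRegular_of_M2Identification ha hb F hP hQ hPM hQM hw₁Z hw₂Z hw₁0 hw₂0 hw₁r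
          hw₂r (k₁ := (1 / 2 : ℂ) • x₀ + m + m') (k₂ := n) (k₃ := n')
          (l₁ := (1 / 2 : ℂ) • x₀ + m + w₂ - m') (l₂ := n) (l₃ := -n')
          (add_mem (add_mem hhZ hm) hm') (sub_mem (add_mem (add_mem hhZ hm) hw₂Z) hm') hn hn
          hn' (neg_mem hn') ?_ ?_
        · rw [haeq, hmn, hmn']
          abel
        · rw [hbeq, mul_sub, mul_one, hmn, hmn', neg_mul]
          abel
    have hrel : ∀ T Q : H →L[ℂ] H, T ∈ generatedVN {a, b} → (Q = q ∨ Q = 1 - q) →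
        (1 - Q = q ∨ 1 - Q = 1 - q) → T - (1 / 2 : ℂ) • x₀ = w₁ * p + w₂ * Q →
        IsRelStrictIn (generatedVN {a, b}) x₀ T := by
      intro T Q hTM hQ hQ' hT
      have hsub : 1 - x₀ - (T - (1 / 2 : ℂ) • x₀) = w₁ * (1 - p) + w₂ * (1 - Q) := by
        rw [hT, ← hsum]
        noncomm_ring
      refine (isStrictIn_ringInverse_mul_iff (sub_nonneg.2 hx1) (sub_mem (one_mem _) hxZ)
        (isUnit_one_sub_of_norm_lt_one hxn)).2 ⟨sub_mem hTM hhZ.1, ⟨?_, ?_⟩, ?_, ?_⟩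
      · rw [hT]
        exact (hcorner p Q (Or.inl rfl) hQ).1
      · rw [← sub_nonneg, hsub]
        exact (hcorner (1 - p) (1 - Q) (Or.inr rfl) hQ').1
      · rw [hT]
        exact (hcorner p Q (Or.inl rfl) hQ).2
      · rw [hsub]
        exact (hcorner (1 - p) (1 - Q) (Or.inr rfl) hQ').2
    constructor
    · refine hrel a q (subset_generatedVN _ (Or.inl rfl)) (Or.inl rfl) (Or.inr rfl) ?_
      rw [haeq, add_assoc, add_sub_cancel_left]
    · refine hrel b (1 - q) (subset_generatedVN _ (Or.inr rfl)) (Or.inr rfl)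
        (Or.inl (sub_sub_cancel 1 q)) ?_
      rw [hbeq, add_assoc, add_sub_cancel_left]

end Decomposition

theorem mainTheorem4 {H : Type*} [NormedAddCommGroup H] [InnerProductSpace ℂ H] [CompleteSpace H]
    (a b x₀ : H →L[ℂ] H) (ha : a ∈ effects H) (hb : b ∈ effects H)
    (hx₀_pos : 0 ≤ x₀) (hx₀_central : x₀ ∈ vnCentre (generatedVN {a, b})) (hx₀_norm : ‖x₀‖ < 1) :
    ((IsCompatibleRel x₀ a b ∧
        IsRelStrictIn (generatedVN {a, b}) x₀ a ∧ IsRelStrictIn (generatedVN {a, b}) x₀ b) ↔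
      ∃ p q w₁ w₂ : H →L[ℂ] H,
        IsM2StrictProjection (generatedVN {a, b}) p ∧
        IsM2StrictProjection (generatedVN {a, b}) q ∧
        IsRelDecomposition (generatedVN {a, b}) x₀ a b p q w₁ w₂) ∧
    ((IsCompatibleRel x₀ a b ∧
        IsRelStrictIn (generatedVN {a, b}) x₀ a ∧ IsRelStrictIn (generatedVN {a, b}) x₀ b) ↔
      ∃ (F : M2Identification (generatedVN {a, b})) (p q w₁ w₂ : H →L[ℂ] H),
        IsM2StrictVia F p ∧ IsM2StrictVia F q ∧
        IsRelDecomposition (generatedVN {a, b}) x₀ a b p q w₁ w₂) := by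
  have has : IsSelfAdjoint a := IsSelfAdjoint.of_nonneg ha.1
  have hbs : IsSelfAdjoint b := IsSelfAdjoint.of_nonneg hb.1
  have hforward : IsCompatibleRel x₀ a b ∧ IsRelStrictIn (generatedVN {a, b}) x₀ a ∧
      IsRelStrictIn (generatedVN {a, b}) x₀ b →
      ∃ (F : M2Identification (generatedVN {a, b})) (p q w₁ w₂ : H →L[ℂ] H),
        IsM2StrictVia F p ∧ IsM2StrictVia F q ∧
        IsRelDecomposition (generatedVN {a, b}) x₀ a b p q w₁ w₂ :=
    fun ⟨hc, hsa, hsb⟩ =>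
      exists_isRelDecomposition has hbs hx₀_pos hx₀_central hx₀_norm hc.2.2.2 hsa hsb
  refine ⟨⟨fun h => ?_, ?_⟩, hforward, ?_⟩
  · obtain ⟨F, p, q, w₁, w₂, hp, hq, hd⟩ := hforward h
    exact ⟨p, q, w₁, w₂, ⟨F, hp⟩, ⟨F, hq⟩, hd⟩
  · rintro ⟨p, q, w₁, w₂, ⟨F, hp⟩, ⟨G, hq⟩, hd⟩
    exact isCompatibleRel_of_isRelDecomposition has hbs hx₀_pos hx₀_central hx₀_norm F hp.1 hq.1
      hp.2.1 hq.2.1 hd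
  · rintro ⟨F, p, q, w₁, w₂, hp, hq, hd⟩
    exact isCompatibleRel_of_isRelDecomposition has hbs hx₀_pos hx₀_central hx₀_norm F hp.1 hq.1
      hp.2.1 hq.2.1 hd
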